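/- **Setting.** For a diffeological space $X$ let $\Omega(X)$ be Souriau's de Rham complex (a $q$-form is a natural transformation from plots $U\to X$, with $U$ open in a Euclidean space, to smooth $q$-forms on $U$), and let $A(X)$ be the singular de Rham complex, whose $q$-forms are the simplicial maps from $S^D_\bullet(X)=\{C^\infty(\mathbb A^n,X)\}_n$ to $\{\Omega^q(\mathbb A^n)\}_n$, where $\mathbb A^n=\{x\in\mathbb R^{n+1}\mid \sum x_i=1\}$. Let $K=\Omega$ or $K=A$. For a generating family $\mathcal G$ of $X$ (a family of plots, possibly with repetitions) let $\mathcal N=\coprod_{\varphi\in\mathcal G}\{\varphi\}\times\mathrm{dom}(\varphi)$ be its nebula, $ev(\varphi,r)=\varphi(r)$, and let $\mathsf M$ be the gauge monoid of smooth maps $f:\mathcal N\to\mathcal N$ with $ev\circ f=ev$ that are the identity on all but finitely many components. Let $C^{p,q}=\mathrm{map}(\mathsf M^p,K^q(\mathcal N))$ be the Hochschild double complex, with horizontal differential $\delta$ the Hochschild differential of the monoid $\mathsf M^{op}$ with coefficients in $K^q(\mathcal N)$ (left action $f\cdot\omega=f^*\omega$, trivial right action), and vertical differential $d_K$ induced by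 the differential of $K(\mathcal N)$. The filtration $F^j=\bigoplus_{q\ge j}C^{*,q}$ of the total complex gives the Čech–de Rham spectral sequence $\{{}_KE_r^{p,q},d_r\}_{r\ge 0}$, with $d_r$ of bidegree $(1-r,r)$. Let $\pi:Y\to X$ be a subduction and $\mathcal G_Y$ a generating family of $Y$. Give $X$ the generating multi-family $\mathcal G_X=\coprod_{\varphi\in\mathcal G_Y}\{\pi\circ\varphi\}$. Let $\pi:\mathcal N_Y\to\mathcal N_X$ be the map $(\varphi,r)\mapsto(\pi\circ\varphi,r)$, and for $\eta\in\mathsf M_Y$ let $\underline\eta\in\mathsf M_X$ be given by $\underline\eta(\pi\circ\varphi,r)=(\pi\circ\psi,s)$ if $\eta(\varphi,r)=(\psi,s)$. Define $$\widetilde\pi:C_X^{p,q}=\mathrm{map}(\mathsf M_X^p,K^q(\mathcal N_X))\to C_Y^{p,q}=\mathrm{map}(\mathsf M_Y^p,K^q(\mathcal N_Y)),\qquad \widetilde\pi(\varphi)(\eta_1,\dots,\eta_p)=\pi^*\bigl(\varphi(\underline{\eta_1},\dots,\underline{\eta_p})\bigr).$$ **Proposition.** For $K=\Omega$ and for $K=A$,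 the map $\widetilde\pi$ commutes with both $\delta$ and $d_K$. It induces a morphism of spectral sequences $\{f(\widetilde\pi)_r\}:\{{}_KE_r^{*,*}(X),d_r\}\to\{{}_KE_r^{*,*}(Y),d_r\}$: there is a unique morphism of spectral sequences that on each page $E_r^{p,q}$ sends the class of an element $x\in F^q\mathrm{Tot}^{p+q}$ with $Dx\in F^{q+r}$ to the class of $\mathrm{Tot}(\widetilde\pi)(x)$. -/

import Mathlib

open scoped ContDiff DirectSum
open CategoryTheory Diffeology

universe u v w

noncomputable section

namespace CechDeRham

/-! ### Diffeological preliminaries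

Diffeological spaces and smooth maps are Mathlib's `DiffeologicalSpace` and `DSmooth`. -/

/-- The Euclidean space `ℝⁿ`. -/
abbrev Euc (n : ℕ) : Type := EuclideanSpace ℝ (Fin n)

/-- The sub-diffeology: a map into a subset is a plot iff it is a plot of the ambient space. -/
instance subDiffeology {X : Type*} [DiffeologicalSpace X] (s : X → Prop) :
    DiffeologicalSpace (Subtype s) where
  plots _ := {p | IsPlot (fun x => (p x : X))}
  constant_plots x := isPlot_const (x := (x : X))
  plot_reparam hp hf := isPlot_reparam hp hf
  locality hp := DiffeologicalSpace.locality hp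

/-- The sum diffeology: the finest diffeology for which all the inclusions
`X i → Σ i, X i` are smooth. -/
@[reducible]
def sumDiffeology {ι : Type*} (X : ι → Type*) [∀ i, DiffeologicalSpace (X i)] :
    DiffeologicalSpace (Σ i, X i) :=
  DiffeologicalSpace.generateFrom
    {P | ∃ (i : ι) (p : Euc P.1 → X i), IsPlot p ∧ P.2 = fun x => ⟨i, p x⟩}

lemma dSmooth_restrict {m n : ℕ} (V : TopologicalSpace.Opens (Euc m))
    (U : TopologicalSpace.Opens (Euc n)) (Q : Euc m → Euc n) (hQ : ContDiffOn ℝ ∞ Q V)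
    (h : Set.MapsTo Q V U) : DSmooth (fun y : V => (⟨Q y, h y.2⟩ : U)) := by
  intro k p hp
  have hp' : ContDiff ℝ ∞ (fun x => (p x : Euc m)) := hp
  exact (hQ.comp_contDiff hp' (fun x => (p x).2) : ContDiff ℝ ∞ (fun x => Q (p x)))

/-- A plot of `X` defined on an open subset of some Euclidean space. -/
structure Plot (X : Type u) [DiffeologicalSpace X] where
  /-- the dimension of the domain -/
  n : ℕ
  /-- the domain -/
  dom : TopologicalSpace.Opens (Euc n)
  /-- the underlying map -/
  toFun : dom → X
  smooth : DSmooth toFun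

namespace Plot

variable {X : Type u} {Y : Type v} [DiffeologicalSpace X] [DiffeologicalSpace Y]

/-- The composite `f ∘ P` of a plot `P` with a smooth map `f`. -/
abbrev map (P : Plot X) (f : X → Y) (hf : DSmooth f) : Plot Y where
  n := P.n
  dom := P.dom
  toFun x := f (P.toFun x)
  smooth := hf.comp P.smooth

/-- The composite `P ∘ Q` of a plot `P` with a smooth map `Q : V → dom P`, `V` open in `ℝᵐ`. -/
abbrev reparam (P : Plot X) {m : ℕ} (V : TopologicalSpace.Opens (Euc m)) (Q : Euc m → Euc P.n)
    (hQ : ContDiffOn ℝ ∞ Q V) (h : Set.MapsTo Q V P.dom) : Plot X where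
  n := m
  dom := V
  toFun y := P.toFun ⟨Q y, h y.2⟩
  smooth := P.smooth.comp (dSmooth_restrict V P.dom Q hQ h)

end Plot

/-- A subduction: a smooth surjection along which plots lift locally. -/
structure IsSubduction {X : Type u} {Y : Type v} [DiffeologicalSpace X] [DiffeologicalSpace Y]
    (π : Y → X) : Prop where
  smooth : DSmooth π
  surjective : Function.Surjective π
  lift : ∀ (P : Plot X) (r : P.dom), ∃ (V : TopologicalSpace.Opens (Euc P.n)) (hV : V ≤ P.dom),
    (r : Euc P.n) ∈ V ∧ ∃ Q : V → Y, DSmooth Q ∧ ∀ y : V, P.toFun ⟨y, hV y.2⟩ = π (Q y)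

/-! ### Differential forms on a diffeological space (Souriau) -/

/-- The vector space of alternating `q`-forms on `ℝⁿ`. -/
abbrev Alt (n q : ℕ) : Type := (Euc n) [⋀^Fin q]→L[ℝ] ℝ

/-- `h` is a smooth differential `q`-form on the open set `U`, represented by its extension by zero
to the whole Euclidean space. -/
def IsFormOn {n : ℕ} (q : ℕ) (U : TopologicalSpace.Opens (Euc n)) (h : Euc n → Alt n q) : Prop :=
  ContDiffOn ℝ ∞ h U ∧ ∀ x, x ∉ U → h x = 0

/-- Differential `q`-forms on `X`: natural transformations from plots on open subsets of Euclidean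
spaces to smooth differential forms on their domains. -/
def formSubmodule (q : ℕ) (X : Type u) [DiffeologicalSpace X] :
    Submodule ℝ (∀ P : Plot X, Euc P.n → Alt P.n q) where
  carrier := {α | (∀ P, IsFormOn q P.dom (α P)) ∧
    ∀ (P : Plot X) (m : ℕ) (V : TopologicalSpace.Opens (Euc m)) (Q : Euc m → Euc P.n)
      (hQ : ContDiffOn ℝ ∞ Q V) (h : Set.MapsTo Q V P.dom), ∀ y ∈ V,
      α (P.reparam V Q hQ h) y = (α P (Q y)).compContinuousLinearMap (fderiv ℝ Q y)}
  zero_mem' := by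
    refine ⟨fun P => ⟨contDiffOn_const, fun _ _ => rfl⟩, ?_⟩
    intro P m V Q hQ h y hy
    exact ContinuousAlternatingMap.ext fun v => rfl
  add_mem' := by
    rintro a b ⟨ha, ha'⟩ ⟨hb, hb'⟩
    refine ⟨fun P => ⟨(ha P).1.add (hb P).1, fun x hx => ?_⟩, ?_⟩
    · simp [(ha P).2 x hx, (hb P).2 x hx]
    · intro P m V Q hQ h y hy
      refine ContinuousAlternatingMap.ext fun v => ?_
      exact congrArg₂ (fun S T : Alt m q => S v + T v) (ha' P m V Q hQ h y hy)
        (hb' P m V Q hQ h y hy)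
  smul_mem' := by
    rintro c a ⟨ha, ha'⟩
    refine ⟨fun P => ⟨(ha P).1.const_smul c, fun x hx => ?_⟩, ?_⟩
    · simp [(ha P).2 x hx]
    · intro P m V Q hQ h y hy
      refine ContinuousAlternatingMap.ext fun v => ?_
      exact congrArg (fun S : Alt m q => c • S v) (ha' P m V Q hQ h y hy)

/-- The vector space `Ω^q(X)` of differential `q`-forms on `X`. -/
def Form (q : ℕ) (X : Type u) [DiffeologicalSpace X] : Type u := formSubmodule q X

instance (q : ℕ) (X : Type u) [DiffeologicalSpace X] : AddCommGroup (Form q X) :=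
  (formSubmodule q X).addCommGroup

instance (q : ℕ) (X : Type u) [DiffeologicalSpace X] : Module ℝ (Form q X) :=
  (formSubmodule q X).module

lemma two_le_smooth : minSmoothness ℝ 2 ≤ (∞ : WithTop ℕ∞) := by
  rw [minSmoothness_of_isRCLikeNormedField]
  exact ENat.LEInfty.out

lemma Form.differentiableAt {q : ℕ} {X : Type u} [DiffeologicalSpace X] (α : Form q X)
    (P : Plot X) {x : Euc P.n} (hx : x ∈ P.dom) : DifferentiableAt ℝ (α.1 P) x :=
  ((α.2.1 P).1.contDiffAt (P.dom.isOpen.mem_nhds hx)).differentiableAt (by simp)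

open Classical in
/-- The exterior derivative of the form `α P`, extended by zero outside the domain of `P`. -/
def Form.dFun {q : ℕ} {X : Type u} [DiffeologicalSpace X] (α : Form q X) (P : Plot X)
    (x : Euc P.n) : Alt P.n (q + 1) :=
  if x ∈ P.dom then extDeriv (α.1 P) x else 0

lemma Form.dFun_mem {q : ℕ} {X : Type u} [DiffeologicalSpace X] (α : Form q X) (P : Plot X)
    {x : Euc P.n} (hx : x ∈ P.dom) : α.dFun P x = extDeriv (α.1 P) x := if_pos hx

lemma Form.dFun_notMem {q : ℕ} {X : Type u} [DiffeologicalSpace X] (α : Form q X) (P : Plot X)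
    {x : Euc P.n} (hx : x ∉ P.dom) : α.dFun P x = 0 := if_neg hx

lemma Form.dFun_isFormOn {q : ℕ} {X : Type u} [DiffeologicalSpace X] (α : Form q X) (P : Plot X) :
    IsFormOn (q + 1) P.dom (α.dFun P) := by
  refine ⟨?_, fun x hx => α.dFun_notMem P hx⟩
  have h1 : ContDiffOn ℝ ∞ (fun x => fderiv ℝ (α.1 P) x) P.dom :=
    (α.2.1 P).1.fderiv_of_isOpen P.dom.isOpen (by simp)
  have h2 : ContDiffOn ℝ ∞ (fun x => extDeriv (α.1 P) x) P.dom :=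
    ContDiff.comp_contDiffOn (g := fun T : Euc P.n →L[ℝ] Alt P.n q =>
      ContinuousAlternatingMap.alternatizeUncurryFinCLM ℝ (Euc P.n) ℝ T)
      (ContinuousLinearMap.contDiff _) h1
  exact h2.congr fun x hx => α.dFun_mem P hx

lemma Form.dFun_reparam {q : ℕ} {X : Type u} [DiffeologicalSpace X] (α : Form q X) (P : Plot X)
    (m : ℕ) (V : TopologicalSpace.Opens (Euc m)) (Q : Euc m → Euc P.n) (hQ : ContDiffOn ℝ ∞ Q V)
    (h : Set.MapsTo Q V P.dom) (y : Euc m) (hy : y ∈ V) :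
    α.dFun (P.reparam V Q hQ h) y
      = (α.dFun P (Q y)).compContinuousLinearMap (fderiv ℝ Q y) := by
  have hQy : ContDiffAt ℝ ∞ Q y := hQ.contDiffAt (V.isOpen.mem_nhds hy)
  have he : α.1 (P.reparam V Q hQ h) =ᶠ[nhds y]
      fun z => (α.1 P (Q z)).compContinuousLinearMap (fderiv ℝ Q z) := by
    filter_upwards [V.isOpen.mem_nhds hy] with z hz
    exact α.2.2 P m V Q hQ h z hz
  rw [α.dFun_mem P (h hy), α.dFun_mem (P.reparam V Q hQ h) hy]
  exact he.extDeriv_eq.trans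
    (extDeriv_pullback (α.differentiableAt P (h hy)) hQy two_le_smooth)

lemma Form.dFun_add {q : ℕ} {X : Type u} [DiffeologicalSpace X] (a b : Form q X) (P : Plot X)
    (x : Euc P.n) : (a + b).dFun P x = a.dFun P x + b.dFun P x := by
  by_cases hx : x ∈ P.dom
  · rw [dFun_mem _ _ hx, dFun_mem _ _ hx, dFun_mem _ _ hx]
    exact extDeriv_add (a.differentiableAt P hx) (b.differentiableAt P hx)
  · rw [dFun_notMem _ _ hx, dFun_notMem _ _ hx, dFun_notMem _ _ hx, add_zero]

lemma Form.dFun_smul {q : ℕ} {X : Type u} [DiffeologicalSpace X] (c : ℝ) (a : Form q X)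
    (P : Plot X) (x : Euc P.n) : (c • a).dFun P x = c • a.dFun P x := by
  by_cases hx : x ∈ P.dom
  · rw [dFun_mem _ _ hx, dFun_mem _ _ hx]
    exact extDeriv_smul c (a.1 P)
  · rw [dFun_notMem _ _ hx, dFun_notMem _ _ hx, smul_zero]

/-- The de Rham differential on `Ω(X)`, computed plot by plot. -/
def Form.d (q : ℕ) (X : Type u) [DiffeologicalSpace X] : Form q X →ₗ[ℝ] Form (q + 1) X where
  toFun α := ⟨α.dFun, α.dFun_isFormOn, α.dFun_reparam⟩
  map_add' a b := Subtype.ext (funext fun P => funext fun x => a.dFun_add b P x)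
  map_smul' c a := Subtype.ext (funext fun P => funext fun x => Form.dFun_smul c a P x)

lemma Form.d_d (q : ℕ) (X : Type u) [DiffeologicalSpace X] (α : Form q X) :
    Form.d (q + 1) X (Form.d q X α) = 0 := by
  apply Subtype.ext; funext P x
  by_cases hx : x ∈ P.dom
  · have he : (Form.d q X α).1 P =ᶠ[nhds x] extDeriv (α.1 P) := by
      filter_upwards [P.dom.isOpen.mem_nhds hx] with z hz
      exact α.dFun_mem P hz
    refine (dFun_mem _ P hx).trans (he.extDeriv_eq.trans ?_)
    exact extDeriv_extDeriv_apply ((α.2.1 P).1.contDiffAt (P.dom.isOpen.mem_nhds hx))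
      two_le_smooth
  · exact dFun_notMem _ P hx

/-- The pullback `f^* : Ω^q(Y) → Ω^q(X)`, `(f^* α)(P) = α(f ∘ P)`. -/
def Form.pullback {X : Type u} {Y : Type v} [DiffeologicalSpace X] [DiffeologicalSpace Y]
    (f : X → Y) (hf : DSmooth f) (q : ℕ) : Form q Y →ₗ[ℝ] Form q X where
  toFun α := ⟨fun P => α.1 (P.map f hf), fun P => α.2.1 (P.map f hf),
    fun P m V Q hQ h y hy => α.2.2 (P.map f hf) m V Q hQ h y hy⟩
  map_add' _ _ := rfl
  map_smul' _ _ := rfl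

/-! ### The singular de Rham complex -/

/-- The affine space `𝔸ⁿ = {x ∈ ℝⁿ⁺¹ | ∑ xᵢ = 1}` with its sub-diffeology. -/
abbrev Aff (n : ℕ) : Type := {x : EuclideanSpace ℝ (Fin (n + 1)) // ∑ i, x i = 1}

/-- The affine map `𝔸ᵐ → 𝔸ⁿ` that sends the `i`-th vertex to the `θ i`-th vertex. -/
def Aff.map {m n : ℕ} (θ : Fin (m + 1) →o Fin (n + 1)) (x : Aff m) : Aff n :=
  ⟨WithLp.toLp 2 fun j => ∑ i with θ i = j, x.1 i, by
    simpa using (Finset.sum_fiberwise Finset.univ θ fun i => x.1 i).trans x.2⟩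

lemma Aff.map_smooth {m n : ℕ} (θ : Fin (m + 1) →o Fin (n + 1)) : DSmooth (Aff.map θ) := by
  intro k p hp
  have hp' : ContDiff ℝ ∞ (fun x => (p x : EuclideanSpace ℝ (Fin (m + 1)))) := hp
  have : ContDiff ℝ ∞ (fun x => (Aff.map θ (p x) : EuclideanSpace ℝ (Fin (n + 1)))) := by
    rw [contDiff_euclidean] at hp' ⊢
    intro j
    exact ContDiff.sum (s := Finset.univ.filter fun i => θ i = j) fun i _ => hp' i
  exact this

/-- The set `S^D_n(X)` of smooth maps `𝔸ⁿ → X`. -/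
abbrev Simplex (n : ℕ) (X : Type u) [DiffeologicalSpace X] : Type u :=
  {σ : Aff n → X // DSmooth σ}

/-- The simplicial structure of `S^D_•(X)`. -/
def Simplex.pre {X : Type u} [DiffeologicalSpace X] {m n : ℕ} (θ : Fin (m + 1) →o Fin (n + 1))
    (σ : Simplex n X) : Simplex m X :=
  ⟨σ.1 ∘ Aff.map θ, σ.2.comp (Aff.map_smooth θ)⟩

/-- Simplicial maps from `S^D_•(X)` to `(A_DR^q)_•`, where `(A_DR^q)_n = Ω^q(𝔸ⁿ)`. -/
def sformSubmodule (q : ℕ) (X : Type u) [DiffeologicalSpace X] :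
    Submodule ℝ (∀ n : ℕ, Simplex n X → Form q (Aff n)) where
  carrier := {α | ∀ (m n : ℕ) (θ : Fin (m + 1) →o Fin (n + 1)) (σ : Simplex n X),
    α m (σ.pre θ) = Form.pullback (Aff.map θ) (Aff.map_smooth θ) q (α n σ)}
  zero_mem' := fun _ _ _ _ => rfl
  add_mem' := fun {a b} ha hb m n θ σ => by
    simp only [Pi.add_apply, map_add, ha m n θ σ, hb m n θ σ]
  smul_mem' := fun c a ha m n θ σ => by
    simp only [Pi.smul_apply, map_smul, ha m n θ σ]

/-- The vector space `A^q(X)` of singular differential `q`-forms on `X`. -/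
def SForm (q : ℕ) (X : Type u) [DiffeologicalSpace X] : Type u := sformSubmodule q X

instance (q : ℕ) (X : Type u) [DiffeologicalSpace X] : AddCommGroup (SForm q X) :=
  (sformSubmodule q X).addCommGroup

instance (q : ℕ) (X : Type u) [DiffeologicalSpace X] : Module ℝ (SForm q X) :=
  (sformSubmodule q X).module

lemma Form.pullback_d {X : Type u} {Y : Type v} [DiffeologicalSpace X] [DiffeologicalSpace Y]
    (f : X → Y) (hf : DSmooth f) (q : ℕ) (α : Form q Y) :
    Form.pullback f hf (q + 1) (Form.d q Y α) = Form.d q X (Form.pullback f hf q α) := rfl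

/-- The differential of `A(X)`, computed simplex by simplex. -/
def SForm.d (q : ℕ) (X : Type u) [DiffeologicalSpace X] : SForm q X →ₗ[ℝ] SForm (q + 1) X where
  toFun α := ⟨fun n σ => Form.d q (Aff n) (α.1 n σ), fun m n θ σ =>
    congrArg (Form.d q (Aff m)) (α.2 m n θ σ)⟩
  map_add' a b := by
    apply Subtype.ext; funext n σ
    exact map_add (Form.d q (Aff n)) (a.1 n σ) (b.1 n σ)
  map_smul' c a := by
    apply Subtype.ext; funext n σ
    exact map_smul (Form.d q (Aff n)) c (a.1 n σ)

lemma SForm.d_d (q : ℕ) (X : Type u) [DiffeologicalSpace X] (α : SForm q X) :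
    SForm.d (q + 1) X (SForm.d q X α) = 0 := by
  apply Subtype.ext; funext n σ
  exact Form.d_d q (Aff n) (α.1 n σ)

/-- The pullback `f^* : A^q(Y) → A^q(X)`, `(f^* α)(σ) = α(f ∘ σ)`. -/
def SForm.pullback {X : Type u} {Y : Type v} [DiffeologicalSpace X] [DiffeologicalSpace Y]
    (f : X → Y) (hf : DSmooth f) (q : ℕ) : SForm q Y →ₗ[ℝ] SForm q X where
  toFun α := ⟨fun n σ => α.1 n ⟨f ∘ σ.1, hf.comp σ.2⟩, fun m n θ σ =>
    α.2 m n θ ⟨f ∘ σ.1, hf.comp σ.2⟩⟩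
  map_add' _ _ := rfl
  map_smul' _ _ := rfl

lemma SForm.pullback_d {X : Type u} {Y : Type v} [DiffeologicalSpace X] [DiffeologicalSpace Y]
    (f : X → Y) (hf : DSmooth f) (q : ℕ) (α : SForm q Y) :
    SForm.pullback f hf (q + 1) (SForm.d q Y α) = SForm.d q X (SForm.pullback f hf q α) := rfl

/-- A contravariant functor from diffeological spaces to nonnegatively graded real cochain
complexes. -/
structure DeRhamFunctor where
  /-- the degree `q` part of the complex of `X` -/
  obj (X : Type w) [DiffeologicalSpace X] (q : ℕ) : Type w
  [grp (X : Type w) [DiffeologicalSpace X] (q : ℕ) : AddCommGroup (obj X q)]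
  [mod (X : Type w) [DiffeologicalSpace X] (q : ℕ) : Module ℝ (obj X q)]
  /-- the differential -/
  d (X : Type w) [DiffeologicalSpace X] (q : ℕ) : obj X q →ₗ[ℝ] obj X (q + 1)
  d_d (X : Type w) [DiffeologicalSpace X] (q : ℕ) (x : obj X q) : d X (q + 1) (d X q x) = 0
  /-- the pullback along a smooth map -/
  map {X Y : Type w} [DiffeologicalSpace X] [DiffeologicalSpace Y] (f : X → Y) (hf : DSmooth f)
    (q : ℕ) : obj Y q →ₗ[ℝ] obj X q
  map_id (X : Type w) [DiffeologicalSpace X] (q : ℕ) (x : obj X q) : map id dSmooth_id q x = x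
  map_comp {X Y Z : Type w} [DiffeologicalSpace X] [DiffeologicalSpace Y] [DiffeologicalSpace Z]
    (f : X → Y) (hf : DSmooth f) (g : Y → Z) (hg : DSmooth g) (q : ℕ) (x : obj Z q) :
    map (g ∘ f) (hg.comp hf) q x = map f hf q (map g hg q x)
  map_d {X Y : Type w} [DiffeologicalSpace X] [DiffeologicalSpace Y] (f : X → Y) (hf : DSmooth f)
    (q : ℕ) (x : obj Y q) : map f hf (q + 1) (d Y q x) = d X q (map f hf q x)

attribute [instance] DeRhamFunctor.grp DeRhamFunctor.mod

/-- The de Rham complex `Ω` of Souriau. -/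
def souriau : DeRhamFunctor.{w} where
  obj X _ q := Form q X
  d X _ q := Form.d q X
  d_d X _ q x := Form.d_d q X x
  map f hf q := Form.pullback f hf q
  map_id _ _ _ _ := rfl
  map_comp _ _ _ _ _ _ := rfl
  map_d f hf q x := Form.pullback_d f hf q x

/-- The singular de Rham complex `A`. -/
def singular : DeRhamFunctor.{w} where
  obj X _ q := SForm q X
  d X _ q := SForm.d q X
  d_d X _ q x := SForm.d_d q X x
  map f hf q := SForm.pullback f hf q
  map_id _ _ _ _ := rfl
  map_comp _ _ _ _ _ _ := rfl
  map_d f hf q x := SForm.pullback_d f hf q x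

/-! ### Generating families, nebulae, gauge monoids -/

/-- An indexed generating family of the diffeology of `X`. A generating family in the sense of a
set `𝒢` of plots is the case where the index set is `𝒢` itself; the index set allows one to count
plots with multiplicity. -/
structure GeneratingFamily (X : Type u) [DiffeologicalSpace X] where
  /-- the index set -/
  index : Type w
  /-- the plots of the family -/
  plot : index → Plot X
  generates : ∀ (P : Plot X) (r : P.dom),
    ∃ (V : TopologicalSpace.Opens (Euc P.n)) (hV : V ≤ P.dom), (r : Euc P.n) ∈ V ∧
      ((∃ x : X, ∀ y : V, P.toFun ⟨y, hV y.2⟩ = x) ∨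
        ∃ (i : index) (Q : V → (plot i).dom), DSmooth Q ∧
          ∀ y : V, P.toFun ⟨y, hV y.2⟩ = (plot i).toFun (Q y))

/-- The multi-family `∐_{φ ∈ 𝒢} {π ∘ φ}` of plots of `X` that a generating family `𝒢` of `Y`
induces along a subduction `π : Y → X`. -/
def GeneratingFamily.push {X : Type u} {Y : Type v} [DiffeologicalSpace X] [DiffeologicalSpace Y]
    (𝒢 : GeneratingFamily.{v, w} Y) (π : Y → X) (hπ : IsSubduction π) :
    GeneratingFamily.{u, w} X where
  index := 𝒢.index
  plot i := (𝒢.plot i).map π hπ.smooth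
  generates P r := by
    obtain ⟨V, hV, hr, Q, hQ, hPQ⟩ := hπ.lift P r
    obtain ⟨W, hW, hrW, h⟩ := 𝒢.generates ⟨P.n, V, Q, hQ⟩ ⟨r, hr⟩
    refine ⟨W, hW.trans hV, hrW, ?_⟩
    rcases h with ⟨x, hx⟩ | ⟨i, R, hR, hRe⟩
    · refine Or.inl ⟨π x, fun y => ?_⟩
      rw [← hx y]
      exact hPQ ⟨y, hW y.2⟩
    · refine Or.inr ⟨i, R, hR, fun y => ?_⟩
      exact (hPQ ⟨y, hW y.2⟩).trans (congrArg π (hRe y))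

section Nebula

variable {X : Type u} [DiffeologicalSpace X]

/-- The nebula `∐_φ {φ} × dom φ` of a generating family. -/
def Nebula (𝒢 : GeneratingFamily.{u, w} X) : Type w := Σ i : 𝒢.index, (𝒢.plot i).dom

instance (𝒢 : GeneratingFamily.{u, w} X) : DiffeologicalSpace (Nebula 𝒢) :=
  sumDiffeology fun i : 𝒢.index => (𝒢.plot i).dom

/-- The evaluation map `ev (φ, r) = φ(r)`. -/
def ev (𝒢 : GeneratingFamily.{u, w} X) (z : Nebula 𝒢) : X := (𝒢.plot z.1).toFun z.2

/-- The support of a self-map of the nebula: the set of (indices of) components on which it is not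
the identity. -/
def supp (𝒢 : GeneratingFamily.{u, w} X) (f : Nebula 𝒢 → Nebula 𝒢) : Set 𝒢.index :=
  {i | ∃ r : (𝒢.plot i).dom, f ⟨i, r⟩ ≠ ⟨i, r⟩}

/-- The gauge monoid: smooth self-maps of the nebula over `X` with finite support. -/
def gaugeMonoid (𝒢 : GeneratingFamily.{u, w} X) : Submonoid (Function.End (Nebula 𝒢)) where
  carrier := {f | DSmooth f ∧ (∀ z, ev 𝒢 (f z) = ev 𝒢 z) ∧ (supp 𝒢 f).Finite}
  one_mem' := by
    refine ⟨dSmooth_id, fun _ => rfl, ?_⟩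
    convert Set.finite_empty
    exact Set.eq_empty_of_forall_notMem fun i ⟨r, hr⟩ => hr rfl
  mul_mem' := by
    rintro f g ⟨hf, hf', hf''⟩ ⟨hg, hg', hg''⟩
    refine ⟨hf.comp hg, fun z => (hf' (g z)).trans (hg' z), (hf''.union hg'').subset ?_⟩
    rintro i ⟨r, hr⟩
    by_contra hi
    simp only [Set.mem_union, supp, Set.mem_ofPred_eq, not_or, not_exists, not_not] at hi
    exact hr ((congrArg f (hi.2 r)).trans (hi.1 r))

end Nebula

/-! ### The Hochschild double complex of a monoid acting on a cochain complex -/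

/-- A real cochain complex with a left action of a monoid `G` by cochain maps. -/
structure CochainRep (G : Type w) [Monoid G] where
  /-- the degree `q` part -/
  V : ℕ → Type w
  [grp (q : ℕ) : AddCommGroup (V q)]
  [mod (q : ℕ) : Module ℝ (V q)]
  /-- the differential -/
  d (q : ℕ) : V q →ₗ[ℝ] V (q + 1)
  d_d (q : ℕ) (x : V q) : d (q + 1) (d q x) = 0
  /-- the action -/
  ρ (q : ℕ) : Representation ℝ G (V q)
  ρ_d (q : ℕ) (g : G) (x : V q) : ρ (q + 1) g (d q x) = d q (ρ q g x)

attribute [instance] CochainRep.grp CochainRep.mod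

/-- The gauge monoid acts on `K(𝒩)` from the left through `𝖬ᵒᵖ`, by pullback. -/
def gaugeRep (K : DeRhamFunctor.{w}) {X : Type u} [DiffeologicalSpace X]
    (𝒢 : GeneratingFamily.{u, w} X) : CochainRep (gaugeMonoid 𝒢)ᵐᵒᵖ where
  V q := K.obj (Nebula 𝒢) q
  d q := K.d (Nebula 𝒢) q
  d_d q x := K.d_d (Nebula 𝒢) q x
  ρ q :=
    { toFun := fun f => K.map f.unop.1 f.unop.2.1 q
      map_one' := LinearMap.ext fun x => K.map_id (Nebula 𝒢) q x
      map_mul' := fun f g => LinearMap.ext fun x =>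
        K.map_comp f.unop.1 f.unop.2.1 g.unop.1 g.unop.2.1 q x }
  ρ_d q f x := K.map_d f.unop.1 f.unop.2.1 q x

namespace CochainRep

variable {G : Type w} [Monoid G] (R : CochainRep.{w} G)

/-- The space `C^{p,q} = map(G^p, V^q)` of Hochschild cochains. -/
abbrev C (p q : ℕ) : Type w := (Fin p → G) → R.V q

/-- The `i`-th coface of Hochschild cochains with values in a bimodule with trivial right action. -/
def coface (p q : ℕ) : Fin (p + 2) → R.C p q →ₗ[ℝ] R.C (p + 1) q :=
  Fin.cases
    { toFun := fun φ g => R.ρ q (g 0) (φ fun k => g k.succ)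
      map_add' := fun _ _ => funext fun _ => map_add _ _ _
      map_smul' := fun _ _ => funext fun _ => map_smul _ _ _ }
    fun j =>
    { toFun := fun φ g => φ (Fin.contractNth j (· * ·) g)
      map_add' := fun _ _ => rfl
      map_smul' := fun _ _ => rfl }

/-- The Hochschild differential
`(δφ)(g₁, …, g_{p+1}) = g₁ φ(g₂, …, g_{p+1}) + ∑ (-1)^i φ(g₁, …, gᵢ gᵢ₊₁, …, g_{p+1})
  + (-1)^{p+1} φ(g₁, …, g_p)`; `Fin.contractNth (Fin.last p)` drops the last entry. -/
def δ (p q : ℕ) : R.C p q →ₗ[ℝ] R.C (p + 1) q :=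
  ∑ i : Fin (p + 2), (-1 : ℝ) ^ (i : ℕ) • R.coface p q i

lemma δ_apply (p q : ℕ) (φ : R.C p q) (g : Fin (p + 1) → G) :
    R.δ p q φ g = R.ρ q (g 0) (φ fun k => g k.succ) +
      ∑ j : Fin (p + 1), (-1 : ℝ) ^ (j + 1 : ℕ) • φ (Fin.contractNth j (· * ·) g) := by
  simp [δ, Fin.sum_univ_succ, coface]

/-- The differential on Hochschild cochains induced by the differential of the coefficients. -/
def dV (p q : ℕ) : R.C p q →ₗ[ℝ] R.C p (q + 1) where
  toFun φ g := R.d q (φ g)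
  map_add' _ _ := funext fun _ => map_add _ _ _
  map_smul' _ _ := funext fun _ => map_smul _ _ _

lemma dV_dV (p q : ℕ) (φ : R.C p q) : R.dV p (q + 1) (R.dV p q φ) = 0 :=
  funext fun _ => R.d_d q _

lemma dV_δ (p q : ℕ) (φ : R.C p q) : R.dV (p + 1) q (R.δ p q φ) = R.δ p (q + 1) (R.dV p q φ) := by
  funext g
  rw [δ_apply]
  change R.d q (R.δ p q φ g) = _
  rw [δ_apply, map_add, map_sum, ← R.ρ_d]
  simp only [map_smul]
  rfl

lemma contract_contract {p : ℕ} (i j : Fin (p + 1)) (h : i ≤ j) (g : Fin (p + 2) → G) :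
    Fin.contractNth i (· * ·) (Fin.contractNth j.succ (· * ·) g)
      = Fin.contractNth j (· * ·) (Fin.contractNth i.castSucc (· * ·) g) := by
  funext k
  rcases i with ⟨i, hi⟩
  rcases j with ⟨j, hj⟩
  rcases k with ⟨k, hk⟩
  simp only [Fin.mk_le_mk] at h
  simp only [Fin.contractNth, Fin.castSucc_mk, Fin.succ_mk]
  split_ifs <;> first | rfl | omega | simp only [mul_assoc]

lemma contract_zero {p : ℕ} (j : Fin (p + 1)) (g : Fin (p + 2) → G) :
    Fin.contractNth j.succ (· * ·) g 0 = g 0 := by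
  simp [Fin.contractNth]

lemma contract_succ {p : ℕ} (j : Fin (p + 1)) (g : Fin (p + 2) → G) :
    (fun k : Fin p => Fin.contractNth j.succ (· * ·) g k.succ) =
      Fin.contractNth j (· * ·) fun k => g k.succ := by
  funext k
  simp [Fin.contractNth]

lemma coface_coface (p q : ℕ) (i j : Fin (p + 2)) (h : i ≤ j) (φ : R.C p q) :
    R.coface (p + 1) q j.succ (R.coface p q i φ)
      = R.coface (p + 1) q i.castSucc (R.coface p q j φ) := by
  funext g
  induction i using Fin.cases with
  | zero =>
    induction j using Fin.cases with
    | zero =>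
      change R.ρ q (g 0 * g 1) _ = R.ρ q (g 0) (R.ρ q (g 1) _)
      rw [map_mul]
      rfl
    | succ j =>
      change R.ρ q (Fin.contractNth j.succ (· * ·) g 0)
          (φ fun k => Fin.contractNth j.succ (· * ·) g k.succ) =
        R.ρ q (g 0) (φ (Fin.contractNth j (· * ·) fun k => g k.succ))
      rw [contract_zero, contract_succ]
  | succ i =>
    induction j using Fin.cases with
    | zero => exact absurd h (by simp)
    | succ j =>
      exact congrArg φ (contract_contract i j (Fin.succ_le_succ_iff.1 h) g)

lemma δ_δ (p q : ℕ) (φ : R.C p q) : R.δ (p + 1) q (R.δ p q φ) = 0 := by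
  simp only [δ, LinearMap.sum_apply, LinearMap.smul_apply, map_sum, map_smul, Finset.smul_sum,
    smul_smul]
  rw [← Finset.sum_product', Finset.univ_product_univ]
  let S : Finset (Fin (p + 2) × Fin (p + 3)) := {ij | (ij.2 : ℕ) ≤ (ij.1 : ℕ)}
  rw [← Finset.sum_add_sum_compl S, ← eq_neg_iff_add_eq_zero, ← Finset.sum_neg_distrib]
  refine Finset.sum_bij (fun ij hij =>
    (Fin.castLT ij.2 (lt_of_le_of_lt (Finset.mem_filter.mp hij).2 ij.1.is_lt), ij.1.succ))
    ?_ ?_ ?_ ?_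
  · intro ij hij
    simp_rw [S, Finset.compl_filter, Finset.mem_filter_univ, Fin.val_succ, Fin.val_castLT] at hij ⊢
    omega
  · rintro ⟨i, j⟩ hij ⟨i', j'⟩ hij' h
    simp only [Prod.mk.injEq, Fin.ext_iff, Fin.val_castLT] at h ⊢
    exact ⟨by simpa using h.2, h.1⟩
  · rintro ⟨i, j⟩ hij
    simp_rw [S, Finset.compl_filter, Finset.mem_filter_univ, not_le] at hij
    refine ⟨(j.pred ?_, i.castSucc), ?_, ?_⟩
    · rintro rfl
      simp at hij
    · simp only [S, Finset.mem_filter_univ, Fin.val_castSucc, Fin.val_pred]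
      omega
    · simp
  · rintro ⟨j, i⟩ hij
    have hij' : (i : ℕ) ≤ j := (Finset.mem_filter.mp hij).2
    obtain ⟨i', rfl⟩ : ∃ i' : Fin (p + 2), i = i'.castSucc :=
      ⟨i.castLT (by omega), by simp⟩
    simp only [Fin.castLT_castSucc]
    rw [R.coface_coface p q i' j hij', ← neg_smul]
    congr 1
    simp [pow_succ, mul_comm]

end CochainRep

/-! ### The spectral sequence of a filtered cochain complex -/

/-- A real vector space `T` with an endomorphism `D` of square zero, subspaces `gr n` (`n ∈ ℤ`) with
`D (gr n) ⊆ gr (n + 1)`, to be thought of as the homogeneous parts of a cochain complex, and a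
decreasing filtration `fil j` (`j ∈ ℤ`) stable under `D`. -/
structure FilteredComplex where
  /-- the total space -/
  T : Type w
  [grp : AddCommGroup T]
  [mod : Module ℝ T]
  /-- the differential -/
  D : T →ₗ[ℝ] T
  D_D (x : T) : D (D x) = 0
  /-- the homogeneous parts -/
  gr : ℤ → Submodule ℝ T
  D_gr (n : ℤ) (x : T) : x ∈ gr n → D x ∈ gr (n + 1)
  /-- the filtration -/
  fil : ℤ → Submodule ℝ T
  fil_anti : Antitone fil
  D_fil (j : ℤ) (x : T) : x ∈ fil j → D x ∈ fil j

attribute [instance] FilteredComplex.grp FilteredComplex.mod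

namespace FilteredComplex

variable (F : FilteredComplex.{w})

/-- `Z_r^{p,q} = {x ∈ F^q T^{p+q} | D x ∈ F^{q+r}}`. The second index is the filtration degree and
the first one the complementary degree. -/
def Z (r p q : ℤ) : Submodule ℝ F.T := F.gr (p + q) ⊓ F.fil q ⊓ (F.fil (q + r)).comap F.D

/-- `Z_{r-1}^{p-1,q+1} + D Z_{r-1}^{p+r-2,q-r+1}`, the subspace of `Z_r^{p,q}` that is divided out
in `E_r^{p,q}`. -/
def B (r p q : ℤ) : Submodule ℝ F.T :=
  F.Z (r - 1) (p - 1) (q + 1) ⊔ (F.Z (r - 1) (p + r - 2) (q - r + 1)).map F.D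

lemma mem_Z {r p q : ℤ} {x : F.T} :
    x ∈ F.Z r p q ↔ x ∈ F.gr (p + q) ∧ x ∈ F.fil q ∧ F.D x ∈ F.fil (q + r) := by
  simp [Z, and_assoc]

lemma mem_Z_of_eq {r p q r' p' q' : ℤ} {x : F.T} (hx : x ∈ F.Z r p q) (hn : p + q = p' + q')
    (hq : q' ≤ q) (hr : q' + r' ≤ q + r) : x ∈ F.Z r' p' q' := by
  rw [mem_Z] at hx ⊢
  exact ⟨hn ▸ hx.1, F.fil_anti hq hx.2.1, F.fil_anti hr hx.2.2⟩

lemma D_mem_Z {r p q r' p' q' : ℤ} {x : F.T} (hx : x ∈ F.Z r p q) (hn : p + q + 1 = p' + q')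
    (hq : q' ≤ q + r) : F.D x ∈ F.Z r' p' q' := by
  rw [mem_Z] at hx ⊢
  refine ⟨hn ▸ F.D_gr _ _ hx.1, F.fil_anti hq hx.2.2, ?_⟩
  rw [F.D_D]
  exact Submodule.zero_mem _

lemma mem_B {r p q : ℤ} {x : F.T} : x ∈ F.B r p q ↔
    ∃ y ∈ F.Z (r - 1) (p - 1) (q + 1), ∃ z ∈ F.Z (r - 1) (p + r - 2) (q - r + 1),
      y + F.D z = x := by
  simp [B, Submodule.mem_sup]

/-- `E_r^{p,q}`. -/
abbrev E (r p q : ℤ) : Type w := F.Z r p q ⧸ (F.B r p q).submoduleOf (F.Z r p q)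

/-- The class in `E_r^{p,q}` of an element of `Z_r^{p,q}`. -/
def cls (r p q : ℤ) : F.Z r p q →ₗ[ℝ] F.E r p q := Submodule.mkQ _

lemma cls_surjective (r p q : ℤ) : Function.Surjective (F.cls r p q) := Submodule.mkQ_surjective _

lemma cls_eq_zero {r p q : ℤ} {x : F.Z r p q} : F.cls r p q x = 0 ↔ (x : F.T) ∈ F.B r p q := by
  exact Submodule.Quotient.mk_eq_zero _

lemma cls_eq_cls {r p q : ℤ} {x y : F.Z r p q} :
    F.cls r p q x = F.cls r p q y ↔ (x : F.T) - (y : F.T) ∈ F.B r p q := by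
  rw [← sub_eq_zero, ← map_sub, cls_eq_zero]
  rfl

lemma shift {r p q p' q' : ℤ} (h : (p, q) + (1 - r, r) = (p', q')) :
    p' = p + 1 - r ∧ q' = q + r := by
  simp only [Prod.mk_add_mk, Prod.mk.injEq] at h
  omega

/-- `D : Z_r^{p,q} → Z_r^{p',q'}` for `(p', q') = (p, q) + (1 - r, r)`. -/
def DZ {r p q p' q' : ℤ} (h : (p, q) + (1 - r, r) = (p', q')) : F.Z r p q →ₗ[ℝ] F.Z r p' q' :=
  F.D.restrict fun _ hx => F.D_mem_Z hx (by have := shift h; omega) (by have := shift h; omega)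

/-- The differential `d_r : E_r^{p,q} → E_r^{p+1-r,q+r}` induced by `D`. -/
def dE {r p q p' q' : ℤ} (h : (p, q) + (1 - r, r) = (p', q')) : F.E r p q →ₗ[ℝ] F.E r p' q' :=
  Submodule.mapQ _ _ (F.DZ h) (by
    rintro ⟨x, hx⟩ hxB
    change x ∈ F.B r p q at hxB
    change F.D x ∈ F.B r p' q'
    rw [mem_B] at hxB ⊢
    obtain ⟨y, hy, z, hz, rfl⟩ := hxB
    have hs := shift h
    refine ⟨0, Submodule.zero_mem _, y, F.mem_Z_of_eq hy ?_ ?_ ?_, ?_⟩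
    · omega
    · omega
    · omega
    · simp [F.D_D])

lemma dE_cls {r p q p' q' : ℤ} (h : (p, q) + (1 - r, r) = (p', q')) (x : F.Z r p q) :
    F.dE h (F.cls r p q x) = F.cls r p' q' (F.DZ h x) := rfl

open Classical in
/-- The page `E_r` as a complex, with differential of bidegree `(1 - r, r)`. -/
def page (r : ℤ) :
    HomologicalComplex (ModuleCat.{w} ℝ) (ComplexShape.up' ((1 - r, r) : ℤ × ℤ)) where
  X pq := ModuleCat.of ℝ (F.E r pq.1 pq.2)
  d i j := if h : i + (1 - r, r) = j then ModuleCat.ofHom (F.dE h) else 0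
  shape i j h := dif_neg h
  d_comp_d' i j k hij hjk := by
    rw [dif_pos (show i + (1 - r, r) = j from hij), dif_pos (show j + (1 - r, r) = k from hjk)]
    apply ModuleCat.hom_ext
    apply LinearMap.ext
    intro x
    obtain ⟨x, rfl⟩ := F.cls_surjective r i.1 i.2 x
    change F.dE _ (F.dE _ (F.cls _ _ _ x)) = 0
    rw [dE_cls, dE_cls, cls_eq_zero]
    change F.D (F.D x) ∈ _
    rw [F.D_D]
    exact Submodule.zero_mem _

lemma page_d (r : ℤ) {i j : ℤ × ℤ} (h : i + (1 - r, r) = j) :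
    (F.page r).d i j = ModuleCat.ofHom (F.dE h) := dif_pos h

/-- The map `Z_{r+1}^{p,q} → E_r^{p,q}`, `x ↦ [x]`. -/
def toPrev (r r' p q : ℤ) (h : r + 1 = r') : F.Z r' p q →ₗ[ℝ] F.E r p q :=
  F.cls r p q ∘ₗ Submodule.inclusion fun _ hx => F.mem_Z_of_eq hx rfl le_rfl (by omega)

lemma toPrev_apply {r r' p q : ℤ} (h : r + 1 = r') (x : F.Z r' p q)
    (hx : (x : F.T) ∈ F.Z r p q) : F.toPrev r r' p q h x = F.cls r p q ⟨x, hx⟩ := rfl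

lemma next_eq (r : ℤ) (pq : ℤ × ℤ) :
    (ComplexShape.up' ((1 - r, r) : ℤ × ℤ)).next pq = pq + (1 - r, r) :=
  ComplexShape.next_eq' _ rfl

lemma prev_add (r : ℤ) (pq : ℤ × ℤ) :
    (ComplexShape.up' ((1 - r, r) : ℤ × ℤ)).prev pq + (1 - r, r) = pq := by
  have h : (ComplexShape.up' ((1 - r, r) : ℤ × ℤ)).Rel (pq - (1 - r, r)) pq :=
    sub_add_cancel pq (1 - r, r)
  rw [ComplexShape.prev_eq' _ h]
  exact h

/-- The map from `Z_{r+1}^{p,q}` to the cycles of `(E_r, d_r)`, `x ↦ [x]`. -/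
def toCycles (r r' : ℤ) (pq : ℤ × ℤ) (h : r + 1 = r') :
    ModuleCat.of ℝ (F.Z r' pq.1 pq.2) ⟶ (F.page r).cycles pq :=
  (F.page r).liftCycles (ModuleCat.ofHom (F.toPrev r r' pq.1 pq.2 h)) _ (next_eq r pq) (by
    rw [F.page_d r rfl]
    apply ModuleCat.hom_ext
    apply LinearMap.ext
    rintro ⟨x, hx⟩
    change F.dE _ (F.cls _ _ _ _) = 0
    rw [dE_cls, cls_eq_zero, mem_B]
    refine ⟨F.D x, F.D_mem_Z hx ?_ ?_, 0, Submodule.zero_mem _, ?_⟩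
    · simp; omega
    · simp; omega
    · rw [map_zero, add_zero]; rfl)

/-- The map `Z_{r+1}^{p,q} → H^{p,q}(E_r, d_r)`, `x ↦ [[x]]`. -/
def toHomology (r r' : ℤ) (pq : ℤ × ℤ) (h : r + 1 = r') :
    ModuleCat.of ℝ (F.Z r' pq.1 pq.2) ⟶ (F.page r).homology pq :=
  F.toCycles r r' pq h ≫ (F.page r).homologyπ pq

lemma iCycles_toCycles (r r' : ℤ) (pq : ℤ × ℤ) (h : r + 1 = r') (x : F.Z r' pq.1 pq.2) :
    (F.page r).iCycles pq (F.toCycles r r' pq h x) = F.toPrev r r' pq.1 pq.2 h x := by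
  have hh : F.toCycles r r' pq h ≫ (F.page r).iCycles pq =
    ModuleCat.ofHom (F.toPrev r r' pq.1 pq.2 h) := (F.page r).liftCycles_i _ _ _ _
  exact ConcreteCategory.congr_hom hh x

lemma iCycles_toHomology (r r' : ℤ) (pq : ℤ × ℤ) (h : r + 1 = r') (x : F.Z r' pq.1 pq.2)
    (c : (F.page r).cycles pq) (hc : (F.page r).iCycles pq c = F.toPrev r r' pq.1 pq.2 h x) :
    F.toHomology r r' pq h x = (F.page r).homologyπ pq c := by
  refine congrArg ((F.page r).homologyπ pq) ?_
  apply (ModuleCat.mono_iff_injective ((F.page r).iCycles pq)).1 inferInstance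
  rw [hc]
  exact F.iCycles_toCycles r r' pq h x

lemma exists_cycle (r r' : ℤ) (pq : ℤ × ℤ) (h : r + 1 = r') (x : F.Z r' pq.1 pq.2) :
    ∃ c : (F.page r).cycles pq, (F.page r).iCycles pq c = F.toPrev r r' pq.1 pq.2 h x ∧
      F.toHomology r r' pq h x = (F.page r).homologyπ pq c :=
  ⟨F.toCycles r r' pq h x, F.iCycles_toCycles r r' pq h x, rfl⟩

lemma toHomology_surjective (r r' : ℤ) (pq : ℤ × ℤ) (h : r + 1 = r') :
    Function.Surjective (F.toHomology r r' pq h) := by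
  intro y
  obtain ⟨c, rfl⟩ := (ModuleCat.epi_iff_surjective ((F.page r).homologyπ pq)).1 inferInstance y
  obtain ⟨p, q⟩ := pq
  obtain ⟨⟨z, hz⟩, hze⟩ := F.cls_surjective r p q ((F.page r).iCycles (p, q) c)
  have hd := ConcreteCategory.congr_hom ((F.page r).iCycles_d (p, q) ((p, q) + (1 - r, r))) c
  rw [F.page_d r rfl] at hd
  replace hd : F.dE _ ((F.page r).iCycles (p, q) c) = 0 := hd
  rw [← hze, dE_cls, cls_eq_zero, mem_B] at hd
  obtain ⟨u, hu, w, hw, huw⟩ := hd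
  replace huw : u + F.D w = F.D z := huw
  simp only [Prod.mk_add_mk] at hu hw
  have hx : z - w ∈ F.Z r' p q := by
    rw [mem_Z] at hz hw hu ⊢
    refine ⟨?_, ?_, ?_⟩
    · refine Submodule.sub_mem _ hz.1 ?_
      convert hw.1 using 2
      ring
    · exact Submodule.sub_mem _ hz.2.1 (F.fil_anti (by omega) hw.2.1)
    · rw [map_sub, ← huw, add_sub_cancel_right]
      exact F.fil_anti (by omega) hu.2.1
  refine ⟨⟨z - w, hx⟩, F.iCycles_toHomology r r' (p, q) h ⟨z - w, hx⟩ c ?_⟩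
  have hx' : z - w ∈ F.Z r p q := F.mem_Z_of_eq hx rfl le_rfl (by omega)
  refine hze.symm.trans (Eq.trans ?_ (F.toPrev_apply h ⟨z - w, hx⟩ hx').symm)
  rw [cls_eq_cls, mem_B]
  refine ⟨w, F.mem_Z_of_eq hw ?_ ?_ ?_, 0, Submodule.zero_mem _, ?_⟩
  · ring
  · omega
  · omega
  · change w + F.D 0 = z - (z - w)
    simp

lemma homologyπ_eq_zero (r : ℤ) (pq : ℤ × ℤ) (c : (F.page r).cycles pq) :
    (F.page r).homologyπ pq c = 0 ↔ ∃ e : F.E r (pq.1 + r - 1) (pq.2 - r),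
      F.dE (by ext <;> simp) e = (F.page r).iCycles pq c := by
  have hp : (ComplexShape.up' ((1 - r, r) : ℤ × ℤ)).prev pq = (pq.1 + r - 1, pq.2 - r) := by
    rw [← add_right_cancel_iff (a := (1 - r, r)), prev_add]
    ext <;> simp
  have hex := ShortComplex.exact_of_g_is_cokernel
    (ShortComplex.mk _ _ ((F.page r).toCycles_comp_homologyπ (pq.1 + r - 1, pq.2 - r) pq)) ((F.page r).homologyIsCokernel _ pq hp)
  rw [ShortComplex.moduleCat_exact_iff] at hex
  have hi := (ModuleCat.mono_iff_injective ((F.page r).iCycles pq)).1 inferInstance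
  have hti := (F.page r).toCycles_i (pq.1 + r - 1, pq.2 - r) pq
  rw [F.page_d r (by ext <;> simp)] at hti
  constructor
  · intro h0
    obtain ⟨e, he⟩ := hex c h0
    refine ⟨e, ?_⟩
    rw [← he]
    exact (ConcreteCategory.congr_hom hti e).symm
  · rintro ⟨e, he⟩
    have : (F.page r).toCycles (pq.1 + r - 1, pq.2 - r) pq e = c := by
      apply hi
      rw [← he]
      exact ConcreteCategory.congr_hom hti e
    rw [← this]
    exact ConcreteCategory.congr_hom
      ((F.page r).toCycles_comp_homologyπ (pq.1 + r - 1, pq.2 - r) pq) e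

lemma toHomology_eq_zero (r r' : ℤ) (pq : ℤ × ℤ) (h : r + 1 = r') (x : F.Z r' pq.1 pq.2) :
    F.toHomology r r' pq h x = 0 ↔ (x : F.T) ∈ F.B r' pq.1 pq.2 := by
  obtain ⟨c, hc, hc'⟩ := F.exists_cycle r r' pq h x
  obtain ⟨p, q⟩ := pq
  obtain ⟨x, hx⟩ := x
  dsimp only at hx ⊢
  have hx' : x ∈ F.Z r p q := F.mem_Z_of_eq hx rfl le_rfl (by omega)
  rw [hc', homologyπ_eq_zero, hc, F.toPrev_apply h ⟨x, hx⟩ hx', mem_B]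
  subst h
  constructor
  · rintro ⟨e, he⟩
    obtain ⟨⟨w, hw⟩, rfl⟩ := F.cls_surjective _ _ _ e
    rw [dE_cls, cls_eq_cls, mem_B] at he
    obtain ⟨u, hu, v, hv, huv⟩ := he
    replace huv : u + F.D v = F.D w - x := huv
    dsimp only at hw hu hv
    refine ⟨-u, Submodule.neg_mem _ ?_, w - v, Submodule.sub_mem _ ?_ ?_, ?_⟩
    · have hu' : u = F.D w - F.D v - x := by rw [eq_sub_of_add_eq huv, ← sub_eq_zero]; abel_nf
      rw [mem_Z] at hu hx ⊢
      refine ⟨?_, ?_, ?_⟩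
      · convert hu.1 using 2
      · exact F.fil_anti (by omega) hu.2.1
      · rw [hu', map_sub, map_sub, F.D_D, F.D_D, sub_zero, zero_sub]
        exact Submodule.neg_mem _ (F.fil_anti (by omega) hx.2.2)
    · exact F.mem_Z_of_eq hw (by ring) (by omega) (by omega)
    · exact F.mem_Z_of_eq hv (by ring) (by omega) (by omega)
    · rw [map_sub, eq_sub_of_add_eq huv, ← sub_eq_zero]; abel_nf
  · rintro ⟨u, hu, w, hw, huw⟩
    have hw' : w ∈ F.Z r (p + r - 1) (q - r) :=
      F.mem_Z_of_eq hw (by ring) (by omega) (by omega)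
    refine ⟨F.cls r (p + r - 1) (q - r) ⟨w, hw'⟩, ?_⟩
    rw [dE_cls, cls_eq_cls, mem_B]
    refine ⟨-u, Submodule.neg_mem _ (F.mem_Z_of_eq hu ?_ ?_ ?_), 0, Submodule.zero_mem _, ?_⟩
    · ring
    · simp
    · simp
    · change -u + F.D 0 = F.D w - x
      rw [← huw, map_zero]; abel

/-- The isomorphism `E_{r+1}^{p,q} ≅ H^{p,q}(E_r, d_r)` sending the class of `x ∈ Z_{r+1}^{p,q}` to
the class of the cycle `[x] ∈ E_r^{p,q}`. -/
def pageIso (r r' : ℤ) (pq : ℤ × ℤ) (h : r + 1 = r') :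
    (F.page r').X pq ≅ (F.page r).homology pq :=
  LinearEquiv.toModuleIso (LinearEquiv.ofBijective
    (Submodule.liftQ _ (F.toHomology r r' pq h).hom fun x hx =>
      (F.toHomology_eq_zero r r' pq h x).2 hx :
      F.E r' pq.1 pq.2 →ₗ[ℝ] (F.page r).homology pq) (by
    constructor
    · rw [← LinearMap.ker_eq_bot, LinearMap.ker_eq_bot']
      intro e he
      obtain ⟨x, rfl⟩ := F.cls_surjective _ _ _ e
      exact (F.cls_eq_zero).2 ((F.toHomology_eq_zero r r' pq h x).1 he)
    · intro y
      obtain ⟨x, hx⟩ := F.toHomology_surjective r r' pq h y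
      exact ⟨F.cls _ _ _ x, hx⟩))

lemma pageIso_cls (r r' : ℤ) (pq : ℤ × ℤ) (h : r + 1 = r') (x : F.Z r' pq.1 pq.2) :
    (F.pageIso r r' pq h).hom (F.cls r' pq.1 pq.2 x) = F.toHomology r r' pq h x := rfl

/-- The spectral sequence of a filtered complex, with `d_r` of bidegree `(1 - r, r)`. -/
def spectralSequence :
    SpectralSequence (ModuleCat.{w} ℝ) (fun r => ComplexShape.up' ((1 - r, r) : ℤ × ℤ)) 0 where
  page r _ := F.page r
  iso r r' pq h _ := (F.pageIso r r' pq h).symm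

end FilteredComplex

/-! ### The Čech–de Rham spectral sequence -/

namespace CochainRep

variable {G : Type w} [Monoid G] (R : CochainRep.{w} G)

/-- The total space `⨁_{p,q ≥ 0} C^{p,q}`. -/
abbrev Tot : Type w := ⨁ pq : ℕ × ℕ, R.C pq.1 pq.2

/-- The inclusion `C^{p,q} → ⨁ C^{p,q}`. -/
def ι (p q : ℕ) : R.C p q →ₗ[ℝ] R.Tot :=
  DirectSum.lof ℝ (ℕ × ℕ) (fun pq => R.C pq.1 pq.2) (p, q)

/-- The total differential, `δ + (-1)^p d` on `C^{p,q}`. -/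
def totD : R.Tot →ₗ[ℝ] R.Tot :=
  DirectSum.toModule ℝ (ℕ × ℕ) R.Tot fun pq =>
    R.ι (pq.1 + 1) pq.2 ∘ₗ R.δ pq.1 pq.2 + (-1 : ℝ) ^ pq.1 • R.ι pq.1 (pq.2 + 1) ∘ₗ R.dV pq.1 pq.2

lemma totD_ι (p q : ℕ) (φ : R.C p q) : R.totD (R.ι p q φ) =
    R.ι (p + 1) q (R.δ p q φ) + (-1 : ℝ) ^ p • R.ι p (q + 1) (R.dV p q φ) := by
  exact DirectSum.toModule_lof (M := fun pq : ℕ × ℕ => R.C pq.1 pq.2) ℝ (p, q) φ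

lemma totD_totD (x : R.Tot) : R.totD (R.totD x) = 0 := by
  induction x using DirectSum.induction_on with
  | zero => simp
  | of pq φ =>
    obtain ⟨p, q⟩ := pq
    change R.totD (R.totD (R.ι p q φ)) = 0
    rw [totD_ι, map_add, map_smul, totD_ι, totD_ι, δ_δ, dV_dV, dV_δ, map_zero, map_zero, pow_succ,
      smul_zero, add_zero, zero_add, mul_neg_one]
    exact (congrArg (· + _) (neg_smul _ _)).trans (neg_add_cancel _)
  | add x y hx hy => rw [map_add, map_add, hx, hy, add_zero]

/-- The elements of `⨁ C^{p,q}` whose components `(p, q)` with `¬ P p q` vanish. -/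
def supportedOn (P : ℕ → ℕ → Prop) : Submodule ℝ R.Tot where
  carrier := {x | ∀ p q, ¬ P p q → x (p, q) = 0}
  zero_mem' := fun _ _ _ => rfl
  add_mem' := fun {x y} hx hy p q h => by
    change x (p, q) + y (p, q) = 0
    rw [hx p q h, hy p q h, add_zero]
  smul_mem' := fun c x hx p q h => by
    change c • x (p, q) = 0
    rw [hx p q h, smul_zero]

lemma ι_mem (P : ℕ → ℕ → Prop) (p q : ℕ) (h : P p q) (φ : R.C p q) :
    R.ι p q φ ∈ R.supportedOn P := by
  intro p' q' h'
  refine DirectSum.of_eq_of_ne _ _ _ ?_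
  rintro heq
  obtain ⟨rfl, rfl⟩ := Prod.mk.inj heq
  exact h' h

lemma totD_mem (P P' : ℕ → ℕ → Prop) (h1 : ∀ p q, P p q → P' (p + 1) q)
    (h2 : ∀ p q, P p q → P' p (q + 1)) (x : R.Tot) (hx : x ∈ R.supportedOn P) :
    R.totD x ∈ R.supportedOn P' := by
  classical
  rw [← DirectSum.sum_support_of x, map_sum]
  refine Submodule.sum_mem _ fun pq hpq => ?_
  obtain ⟨p, q⟩ := pq
  have hP : P p q := by
    by_contra h
    exact (DFinsupp.mem_support_iff.1 hpq) (hx p q h)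
  change R.totD (R.ι p q _) ∈ _
  rw [totD_ι]
  exact Submodule.add_mem _ (R.ι_mem P' _ _ (h1 p q hP) _)
    (Submodule.smul_mem _ _ (R.ι_mem P' _ _ (h2 p q hP) _))

/-- The total complex of the Hochschild double complex, with the filtration
`F^j = ⨁_{q ≥ j} C^{*,q}`. -/
def total : FilteredComplex.{w} where
  T := R.Tot
  D := R.totD
  D_D := R.totD_totD
  gr n := R.supportedOn fun p q => (p + q : ℤ) = n
  D_gr n := R.totD_mem _ _ (fun p q h => by push_cast; omega) (fun p q h => by push_cast; omega)
  fil j := R.supportedOn fun _ q => j ≤ (q : ℤ)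
  fil_anti := fun _ _ hij x hx p q h => hx p q fun h' => h (hij.trans h')
  D_fil j := R.totD_mem _ _ (fun p q h => h) (fun p q h => by push_cast; omega)

end CochainRep

/-- The filtered total complex of the double complex `C^{p,q} = map(𝖬^p, K^q(𝒩))` attached to a
generating family. -/
def cechComplex (K : DeRhamFunctor.{w}) {X : Type u} [DiffeologicalSpace X]
    (𝒢 : GeneratingFamily.{u, w} X) : FilteredComplex.{w} := (gaugeRep K 𝒢).total

/-! ### The maps induced by a subduction -/

section Push

variable {X : Type u} {Y : Type v} [DiffeologicalSpace X] [DiffeologicalSpace Y]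
  (𝒢 : GeneratingFamily.{v, w} Y) (π : Y → X) (hπ : IsSubduction π)

/-- The map `𝒩_Y → 𝒩_X`, `(φ, r) ↦ (π ∘ φ, r)`. -/
def nebulaMap (z : Nebula 𝒢) : Nebula (𝒢.push π hπ) := ⟨z.1, z.2⟩

/-- The inverse of `nebulaMap`. -/
def nebulaInv (z : Nebula (𝒢.push π hπ)) : Nebula 𝒢 := ⟨z.1, z.2⟩

lemma nebulaMap_smooth : DSmooth (nebulaMap 𝒢 π hπ) := dSmooth_id (X := Nebula 𝒢)

lemma nebulaInv_smooth : DSmooth (nebulaInv 𝒢 π hπ) := dSmooth_id (X := Nebula 𝒢)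

/-- The morphism of gauge monoids `𝖬_Y → 𝖬_X`, `η ↦ η̲`, where `η̲(π ∘ φ, r) = (π ∘ ψ, η(r))` if
`η(φ, r) = (ψ, η(r))`. -/
def gaugePush : gaugeMonoid 𝒢 →* gaugeMonoid (𝒢.push π hπ) where
  toFun η := ⟨fun z => nebulaMap 𝒢 π hπ (η.1 (nebulaInv 𝒢 π hπ z)),
    (nebulaMap_smooth 𝒢 π hπ).comp (η.2.1.comp (nebulaInv_smooth 𝒢 π hπ)),
    fun z => congrArg π (η.2.2.1 (nebulaInv 𝒢 π hπ z)),
    η.2.2.2.subset fun _ ⟨r, hr⟩ => ⟨r, fun h => hr (congrArg (nebulaMap 𝒢 π hπ) h)⟩⟩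
  map_one' := rfl
  map_mul' _ _ := rfl

/-- The pullback `π^* : K^q(𝒩_X) → K^q(𝒩_Y)` along `nebulaMap`. -/
def coeffMap (K : DeRhamFunctor.{w}) (q : ℕ) :
    (gaugeRep K (𝒢.push π hπ)).V q →ₗ[ℝ] (gaugeRep K 𝒢).V q :=
  K.map (nebulaMap 𝒢 π hπ) (nebulaMap_smooth 𝒢 π hπ) q

/-- The map `π̃ : C_X^{p,q} → C_Y^{p,q}`, `π̃(φ)(η₁, …, η_p) = π^*(φ(η̲₁, …, η̲_p))`. -/
def cochainMap (K : DeRhamFunctor.{w}) (p q : ℕ) :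
    (gaugeRep K (𝒢.push π hπ)).C p q →ₗ[ℝ] (gaugeRep K 𝒢).C p q where
  toFun φ η := coeffMap 𝒢 π hπ K q (φ fun k => (gaugePush 𝒢 π hπ).op (η k))
  map_add' _ _ := funext fun _ => map_add (coeffMap 𝒢 π hπ K q) _ _
  map_smul' _ _ := funext fun _ => map_smul (coeffMap 𝒢 π hπ K q) _ _

/-- The map that `π̃` induces on total complexes. -/
def totalMap (K : DeRhamFunctor.{w}) :
    (cechComplex K (𝒢.push π hπ)).T →ₗ[ℝ] (cechComplex K 𝒢).T :=
  DirectSum.lmap fun pq : ℕ × ℕ => cochainMap 𝒢 π hπ K pq.1 pq.2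

end Push

end CechDeRham

end

open CechDeRham

/-!
The proof has two independent halves.

The first is the functoriality of the spectral sequence of a filtered complex. A linear map `f` that
commutes with the differentials and respects degrees and filtrations (`FilteredComplex.Hom`) carries
`Z_r^{p,q}` into `Z_r^{p,q}` and `B_r^{p,q}` into `B_r^{p,q}`, hence induces maps
`[x] ↦ [f x]` of the pages, which commute with `d_r` because `d_r [x] = [D x]`
(`FilteredComplex.Hom.mapPage`). The identification of `E_{r+1}` with the homology of `E_r` sends
`[x]` to `[[x]]`, and so do both ways around the naturality square
(`FilteredComplex.Hom.homologyMap_toHomology`), which yields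
`FilteredComplex.Hom.mapSpectralSequence`. Since every element of a page is a class `[x]`, a
morphism of spectral sequences with this effect on classes is unique.

The second is that `π̃` induces such a morphism of total complexes. On each bidegree `π̃` is made of
the monoid morphism `η ↦ η̲` and of the pullback `π^*` of the coefficients, and `π ∘ η = η̲ ∘ π` on
nebulae. By contravariant functoriality `π^*` is therefore equivariant (`coeffMap_ρ`), which gives
the compatibility with the coface that involves the action; the other cofaces only use that
`η ↦ η̲` is multiplicative. The compatibility with the vertical differential is the naturality of
the differential of `K`.
-/

noncomputable section

namespace CechDeRham

/-! ### Functoriality of the spectral sequence of a filtered complex -/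

namespace FilteredComplex

/-- A morphism of filtered complexes: a linear map that commutes with the differentials and
preserves the homogeneous parts and the filtrations. -/
structure Hom (F F' : FilteredComplex.{w}) where
  /-- the map of total spaces -/
  toLinearMap : F.T →ₗ[ℝ] F'.T
  map_D (x : F.T) : toLinearMap (F.D x) = F'.D (toLinearMap x)
  map_gr (n : ℤ) (x : F.T) : x ∈ F.gr n → toLinearMap x ∈ F'.gr n
  map_fil (j : ℤ) (x : F.T) : x ∈ F.fil j → toLinearMap x ∈ F'.fil j

namespace Hom

variable {F F' : FilteredComplex.{w}} (f : Hom F F')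

lemma map_mem_Z {r p q : ℤ} {x : F.T} (hx : x ∈ F.Z r p q) : f.toLinearMap x ∈ F'.Z r p q := by
  rw [mem_Z] at hx ⊢
  refine ⟨f.map_gr _ _ hx.1, f.map_fil _ _ hx.2.1, ?_⟩
  rw [← f.map_D]
  exact f.map_fil _ _ hx.2.2

lemma map_mem_B {r p q : ℤ} {x : F.T} (hx : x ∈ F.B r p q) : f.toLinearMap x ∈ F'.B r p q := by
  rw [mem_B] at hx ⊢
  obtain ⟨y, hy, z, hz, rfl⟩ := hx
  exact ⟨_, f.map_mem_Z hy, _, f.map_mem_Z hz, by rw [map_add, f.map_D]⟩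

/-- The map `Z_r^{p,q} → Z_r^{p,q}` induced by a morphism of filtered complexes. -/
def mapZ (r p q : ℤ) : F.Z r p q →ₗ[ℝ] F'.Z r p q :=
  f.toLinearMap.restrict fun _ hx => f.map_mem_Z hx

/-- The map `E_r^{p,q} → E_r^{p,q}`, `[x] ↦ [f x]`. -/
def mapE (r p q : ℤ) : F.E r p q →ₗ[ℝ] F'.E r p q :=
  Submodule.mapQ _ _ (f.mapZ r p q) fun _ hx => f.map_mem_B hx

lemma mapE_cls (r p q : ℤ) (x : F.Z r p q) :
    f.mapE r p q (F.cls r p q x) = F'.cls r p q (f.mapZ r p q x) := rfl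

lemma mapE_dE {r p q p' q' : ℤ} (h : (p, q) + (1 - r, r) = (p', q')) (e : F.E r p q) :
    f.mapE r p' q' (F.dE h e) = F'.dE h (f.mapE r p q e) := by
  obtain ⟨x, rfl⟩ := F.cls_surjective r p q e
  rw [dE_cls, mapE_cls, mapE_cls, dE_cls]
  exact congrArg (F'.cls r p' q') (Subtype.ext (f.map_D x))

/-- The morphism of complexes `E_r → E_r`, `[x] ↦ [f x]`. -/
def mapPage (r : ℤ) : F.page r ⟶ F'.page r where
  f pq := ModuleCat.ofHom (f.mapE r pq.1 pq.2)
  comm' i j hij := by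
    rw [F.page_d r hij, F'.page_d r hij]
    apply ModuleCat.hom_ext
    apply LinearMap.ext
    intro e
    exact (f.mapE_dE hij e).symm

/-- The identification of a page with the homology of the previous one is natural: the map induced
on the homology of `E_r` sends `[[x]]` to `[[f x]]`. -/
lemma homologyMap_toHomology (r r' : ℤ) (pq : ℤ × ℤ) (h : r + 1 = r') (x : F.Z r' pq.1 pq.2) :
    HomologicalComplex.homologyMap (f.mapPage r) pq (F.toHomology r r' pq h x) =
      F'.toHomology r r' pq h (f.mapZ r' pq.1 pq.2 x) := by
  obtain ⟨c, hc, hc'⟩ := F.exists_cycle r r' pq h x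
  rw [hc']
  -- `[[f x]]` is represented by any cycle of `E_r` that is equal to `[f x]`.
  rw [F'.iCycles_toHomology r r' pq h _ (HomologicalComplex.cyclesMap (f.mapPage r) pq c)]
  · exact ConcreteCategory.congr_hom
      (HomologicalComplex.homologyπ_naturality (f.mapPage r) pq) c
  · refine (ConcreteCategory.congr_hom
      (HomologicalComplex.cyclesMap_i (f.mapPage r) pq) c).trans ?_
    change f.mapE r pq.1 pq.2 ((F.page r).iCycles pq c) = _
    rw [hc]
    rfl

/-- The morphism of spectral sequences induced by a morphism of filtered complexes. -/
def mapSpectralSequence : F.spectralSequence ⟶ F'.spectralSequence where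
  hom r _ := f.mapPage r
  comm r r' pq h _ := by
    change HomologicalComplex.homologyMap (f.mapPage r) pq ≫ (F'.pageIso r r' pq h).inv =
      (F.pageIso r r' pq h).inv ≫ (f.mapPage r').f pq
    rw [Iso.comp_inv_eq, Category.assoc, Iso.eq_inv_comp]
    apply ModuleCat.hom_ext
    apply LinearMap.ext
    intro e
    obtain ⟨x, rfl⟩ := F.cls_surjective _ _ _ e
    exact f.homologyMap_toHomology r r' pq h x

end Hom

/-- A morphism out of the spectral sequence of a filtered complex is determined by its values on
the classes `[x]`. -/
lemma spectralSequence_hom_ext {F : FilteredComplex.{w}}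
    {E : SpectralSequence (ModuleCat.{w} ℝ) (fun r => ComplexShape.up' ((1 - r, r) : ℤ × ℤ)) 0}
    {f g : F.spectralSequence ⟶ E}
    (h : ∀ (r : ℤ) (hr : 0 ≤ r) (p q : ℤ) (x : F.Z r p q),
      (f.hom r hr).f (p, q) (F.cls r p q x) = (g.hom r hr).f (p, q) (F.cls r p q x)) :
    f = g := by
  apply SpectralSequence.hom_ext
  intro r hr
  apply HomologicalComplex.hom_ext
  rintro ⟨p, q⟩
  apply ModuleCat.hom_ext
  apply LinearMap.ext
  intro e
  obtain ⟨x, rfl⟩ := F.cls_surjective r p q e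
  exact h r hr p q x

end FilteredComplex

/-! ### The morphism of double complexes induced by a subduction -/

section Push

variable {X : Type u} {Y : Type v} [DiffeologicalSpace X] [DiffeologicalSpace Y]
  (𝒢 : GeneratingFamily.{v, w} Y) (π : Y → X) (hπ : IsSubduction π) (K : DeRhamFunctor.{w})

/-- Equivariance of the pullback `π^*` of coefficients, obtained by applying `K` to the identity
`η̲ ∘ π = π ∘ η` of maps of nebulae. -/
lemma coeffMap_ρ (q : ℕ) (η : (gaugeMonoid 𝒢)ᵐᵒᵖ) (x : (gaugeRep K (𝒢.push π hπ)).V q) :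
    coeffMap 𝒢 π hπ K q ((gaugeRep K (𝒢.push π hπ)).ρ q ((gaugePush 𝒢 π hπ).op η) x) =
      (gaugeRep K 𝒢).ρ q η (coeffMap 𝒢 π hπ K q x) :=
  (K.map_comp (nebulaMap 𝒢 π hπ) (nebulaMap_smooth 𝒢 π hπ)
      (gaugePush 𝒢 π hπ η.unop).1 (gaugePush 𝒢 π hπ η.unop).2.1 q x).symm.trans
    (K.map_comp η.unop.1 η.unop.2.1 (nebulaMap 𝒢 π hπ) (nebulaMap_smooth 𝒢 π hπ) q x)

/-- A morphism of monoids commutes with the contractions that define the cofaces without the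
action. -/
lemma map_contractNth {G H : Type*} [Monoid G] [Monoid H] (f : G →* H) {p : ℕ} (j : Fin (p + 1))
    (g : Fin (p + 1) → G) :
    (fun k => f (Fin.contractNth j (· * ·) g k)) =
      Fin.contractNth j (· * ·) fun k => f (g k) := by
  funext k
  simp only [Fin.contractNth]
  split_ifs
  · rfl
  · exact map_mul f _ _
  · rfl

lemma cochainMap_δ (p q : ℕ) (φ : (gaugeRep K (𝒢.push π hπ)).C p q) :
    cochainMap 𝒢 π hπ K (p + 1) q ((gaugeRep K (𝒢.push π hπ)).δ p q φ) =
      (gaugeRep K 𝒢).δ p q (cochainMap 𝒢 π hπ K p q φ) := by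
  funext η
  rw [CochainRep.δ_apply]
  change coeffMap 𝒢 π hπ K q ((gaugeRep K (𝒢.push π hπ)).δ p q φ fun k =>
    (gaugePush 𝒢 π hπ).op (η k)) = _
  rw [CochainRep.δ_apply, map_add, map_sum, coeffMap_ρ]
  refine congrArg₂ (· + ·) rfl (Finset.sum_congr rfl fun j _ => ?_)
  rw [map_smul, ← map_contractNth]
  rfl

lemma cochainMap_dV (p q : ℕ) (φ : (gaugeRep K (𝒢.push π hπ)).C p q) :
    cochainMap 𝒢 π hπ K p (q + 1) ((gaugeRep K (𝒢.push π hπ)).dV p q φ) =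
      (gaugeRep K 𝒢).dV p q (cochainMap 𝒢 π hπ K p q φ) :=
  funext fun _ => K.map_d (nebulaMap 𝒢 π hπ) (nebulaMap_smooth 𝒢 π hπ) q _

/-! ### The morphism of total complexes -/

lemma totalMap_ι (p q : ℕ) (φ : (gaugeRep K (𝒢.push π hπ)).C p q) :
    totalMap 𝒢 π hπ K ((gaugeRep K (𝒢.push π hπ)).ι p q φ) =
      (gaugeRep K 𝒢).ι p q (cochainMap 𝒢 π hπ K p q φ) :=
  DirectSum.lmap_lof (fun pq : ℕ × ℕ => cochainMap 𝒢 π hπ K pq.1 pq.2) (p, q) φ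

lemma totalMap_totD (x : (gaugeRep K (𝒢.push π hπ)).Tot) :
    totalMap 𝒢 π hπ K ((gaugeRep K (𝒢.push π hπ)).totD x) =
      (gaugeRep K 𝒢).totD (totalMap 𝒢 π hπ K x) := by
  suffices h : totalMap 𝒢 π hπ K ∘ₗ (gaugeRep K (𝒢.push π hπ)).totD =
      (gaugeRep K 𝒢).totD ∘ₗ totalMap 𝒢 π hπ K from LinearMap.congr_fun h x
  apply DirectSum.linearMap_ext
  rintro ⟨p, q⟩
  apply LinearMap.ext
  intro φ
  change totalMap 𝒢 π hπ K ((gaugeRep K (𝒢.push π hπ)).totD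
      ((gaugeRep K (𝒢.push π hπ)).ι p q φ)) =
    (gaugeRep K 𝒢).totD (totalMap 𝒢 π hπ K ((gaugeRep K (𝒢.push π hπ)).ι p q φ))
  rw [totalMap_ι, CochainRep.totD_ι, CochainRep.totD_ι, ← cochainMap_δ, ← cochainMap_dV,
    ← totalMap_ι, ← totalMap_ι]
  exact (map_add (totalMap 𝒢 π hπ K) _ _).trans
    (congrArg _ (map_smul (totalMap 𝒢 π hπ K) ((-1 : ℝ) ^ p) _))

lemma totalMap_mem_supportedOn (P : ℕ → ℕ → Prop) (x : (gaugeRep K (𝒢.push π hπ)).Tot)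
    (hx : x ∈ (gaugeRep K (𝒢.push π hπ)).supportedOn P) :
    totalMap 𝒢 π hπ K x ∈ (gaugeRep K 𝒢).supportedOn P := by
  intro p q h
  change cochainMap 𝒢 π hπ K p q (x (p, q)) = 0
  rw [hx p q h, map_zero]

/-- `Tot(π̃)` as a morphism of filtered complexes. -/
def totalHom : FilteredComplex.Hom (cechComplex K (𝒢.push π hπ)) (cechComplex K 𝒢) where
  toLinearMap := totalMap 𝒢 π hπ K
  map_D := totalMap_totD 𝒢 π hπ K
  map_gr _ := totalMap_mem_supportedOn 𝒢 π hπ K _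
  map_fil _ := totalMap_mem_supportedOn 𝒢 π hπ K _

end Push

end CechDeRham

end

theorem proposition4p3 {X : Type u} {Y : Type v} [DiffeologicalSpace X] [DiffeologicalSpace Y]
    (π : Y → X) (hπ : IsSubduction π) (𝒢 : GeneratingFamily.{v, w} Y)
    (K : DeRhamFunctor.{w}) (hK : K = souriau ∨ K = singular) :
    (∀ (p q : ℕ) (φ : (gaugeRep K (𝒢.push π hπ)).C p q),
      cochainMap 𝒢 π hπ K (p + 1) q ((gaugeRep K (𝒢.push π hπ)).δ p q φ) =
        (gaugeRep K 𝒢).δ p q (cochainMap 𝒢 π hπ K p q φ)) ∧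
    (∀ (p q : ℕ) (φ : (gaugeRep K (𝒢.push π hπ)).C p q),
      cochainMap 𝒢 π hπ K p (q + 1) ((gaugeRep K (𝒢.push π hπ)).dV p q φ) =
        (gaugeRep K 𝒢).dV p q (cochainMap 𝒢 π hπ K p q φ)) ∧
    ∃! f : (cechComplex K (𝒢.push π hπ)).spectralSequence ⟶ (cechComplex K 𝒢).spectralSequence,
      ∀ (r : ℤ) (hr : 0 ≤ r) (p q : ℤ) (x : (cechComplex K (𝒢.push π hπ)).Z r p q),
        ∃ hx : totalMap 𝒢 π hπ K x ∈ (cechComplex K 𝒢).Z r p q,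
          (f.hom r hr).f (p, q) ((cechComplex K (𝒢.push π hπ)).cls r p q x) =
            (cechComplex K 𝒢).cls r p q ⟨totalMap 𝒢 π hπ K x, hx⟩ := by
  refine ⟨cochainMap_δ 𝒢 π hπ K, cochainMap_dV 𝒢 π hπ K,
    (totalHom 𝒢 π hπ K).mapSpectralSequence,
    fun r _ p q x => ⟨(totalHom 𝒢 π hπ K).map_mem_Z x.2, rfl⟩, fun g hg => ?_⟩
  apply FilteredComplex.spectralSequence_hom_ext
  intro r hr p q x
  obtain ⟨_, hx⟩ := hg r hr p q x
  exact hx
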